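/- Let $s\ge 2$, $0\le t\le k$ and $\lambda\ge 1$ be integers, and write $[s]=\{1,\dots,s\}$, ${\bf 1}=(1,\dots,1)\in[s]^k$, and $d$ for the Hamming distance on $[s]^k$. Define $a_0=\lambda$ and $a_c=\lambda-\sum_{e=0}^{c-1}a_e\binom{k-t}{c-e}(s-1)^{c-e}$ for $c\ge1$. Let $Y=\{{\bf y}\in[s]^k: d({\bf 1},{\bf y})>t\}$, and for ${\bf x}\in[s]^k$ let $J_{\bf x}=\{{\bf y}\in[s]^k: y_i=x_i \text{ for all } i \text{ with } x_i\ne 1\}$. The LP relaxation orthogonal array polytope $\mathrm{OAP}(k,s,t,\lambda)\subseteq\mathbb R^{Y}$ is the set of all $(N_{\bf y})_{{\bf y}\in Y}$ with $N_{\bf y}\ge 0$ for all ${\bf y}\in Y$ and $$a_{t-d({\bf 1},{\bf x})}+(-1)^{t-d({\bf 1},{\bf x})+1}\sum_{{\bf y}\in J_{\bf x}\cap Y}\binom{d({\bf 1},{\bf y})-d({\bf 1},{\bf x})-1}{t-d({\bf 1},{\bf x})}N_{\bf y}\ \ge 0\qquad\text{for all } {\bf x}\in[s]^k \text{ with } d({\bf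 1},{\bf x})\le t .$$ Let $\Pi(\mathrm{OAP}(k,s,t,\lambda))$ be the group of all permutations of the index set $Y$ whose induced permutation of the coordinates of $\mathbb R^{Y}$ maps $\mathrm{OAP}(k,s,t,\lambda)$ onto itself. Let $S_{s-1}\wr S_k$ act on $[s]^k$ by permuting the $k$ factors and, within each factor, the levels $2,\dots,s$ (fixing the level $1$); this action preserves $Y$. Let $H_{k,s,t}$ be the following group of permutations of $Y$: all permutations of $Y$ if $t=0$; the permutations of $Y$ induced by $S_{s-1}\wr S_k$ if $0<t<k$ and ($k>t+1$ or $s>2$); and the trivial group $I$ otherwise. Then $\Pi(\mathrm{OAP}(k,s,t,\lambda))=H_{k,s,t}$. Moreover, if $0<t<k$ and ($k>t+1$ or $s>2$), the action of $S_{s-1}\wr S_k$ on $Y$ is faithful, so that $$\Pi(\mathrm{OAP}(k,s,t,\lambda))\cong\begin{cases}S_{s^k-1}&\text{if } t=0,\\ S_{s-1}\wr S_k&\text{if } 0<t<k \text{ and } (k>t+1 \text{ or } s>2),\\ I&\text{otherwise.}\end{cases}$$ -/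

import Mathlib

open scoped BigOperators

namespace OAPoly

/-- Factor level combinations with `k` factors and `s` levels. The levels `1, …, s` are represented
by the elements `0, …, s - 1` of `Fin s`; in particular the level `1` is `0 : Fin s`, and the
combination `(1, …, 1)` is `0 : Comb k s`. -/
abbrev Comb (k s : ℕ) : Type := Fin k → Fin s

/-- `d(1, x)`: the Hamming distance of `x` from the all-ones combination. -/
def dist1 {k s : ℕ} [NeZero s] (x : Comb k s) : ℕ := hammingDist (0 : Comb k s) x

/-- The index set of the variables `N_y`: combinations `y` with `d(1, y) > t`. -/
abbrev VarIdx (k s t : ℕ) [NeZero s] : Type := {y : Comb k s // t < dist1 y}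

/-- The sequence `a_0 = lam`, `a_c = lam - ∑_{e < c} a_e * C(k - t, c - e) * (s - 1)^(c - e)`. -/
def aSeq (k s t lam : ℕ) (c : ℕ) : ℤ :=
  (lam : ℤ) - ∑ e : Fin c,
    aSeq k s t lam e.val * ((k - t).choose (c - e.val) : ℤ) * ((s : ℤ) - 1) ^ (c - e.val)
termination_by c
decreasing_by exact e.isLt

/-- Membership `y ∈ J_x`: `y` agrees with `x` in every coordinate where `x` is different
from level `1`. -/
def InJ {k s : ℕ} [NeZero s] (x y : Comb k s) : Prop := ∀ i, x i ≠ 0 → y i = x i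

instance {k s : ℕ} [NeZero s] (x y : Comb k s) : Decidable (InJ x y) := by
  unfold InJ; infer_instance

/-- The left-hand side of the inequality attached to a combination `x` with `d(1, x) ≤ t`. -/
def ineqLHS {k s : ℕ} [NeZero s] (t lam : ℕ) (x : Comb k s) (N : VarIdx k s t → ℝ) : ℝ :=
  (aSeq k s t lam (t - dist1 x) : ℝ) +
    (-1) ^ (t - dist1 x + 1) *
      ∑ y : VarIdx k s t with InJ x y.1,
        ((dist1 y.1 - dist1 x - 1).choose (t - dist1 x) : ℝ) * N y

/-- The LP relaxation orthogonal array polytope `OAP(k, s, t, lam)`. -/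
def OAP (k s t lam : ℕ) [NeZero s] : Set (VarIdx k s t → ℝ) :=
  {N | (∀ x : Comb k s, dist1 x ≤ t → 0 ≤ ineqLHS t lam x N) ∧ ∀ y, 0 ≤ N y}

/-- The permutation of the coordinates of `ι → ℝ` given by `σ`: the entry in position `i` is moved
to position `σ i`. -/
def permCoord {ι : Type*} (σ : Equiv.Perm ι) (v : ι → ℝ) : ι → ℝ := fun i => v (σ⁻¹ i)

theorem permCoord_one {ι : Type*} : permCoord (1 : Equiv.Perm ι) = id := rfl

theorem permCoord_mul {ι : Type*} (σ τ : Equiv.Perm ι) :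
    permCoord (σ * τ) = permCoord σ ∘ permCoord τ := by
  funext v i
  simp [permCoord, mul_inv_rev]

/-- The permutation symmetry group of `P`: all coordinate permutations mapping `P` onto itself. -/
def permSymm {ι : Type*} (P : Set (ι → ℝ)) : Subgroup (Equiv.Perm ι) where
  carrier := {σ | permCoord σ '' P = P}
  mul_mem' := by
    intro σ τ hσ hτ
    simp only [Set.mem_ofPred_eq] at *
    rw [permCoord_mul, Set.image_comp, hτ, hσ]
  one_mem' := by
    simp [permCoord_one]
  inv_mem' := by
    intro σ hσ
    simp only [Set.mem_ofPred_eq] at *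
    conv_lhs => rw [← hσ]
    rw [← Set.image_comp, ← permCoord_mul, inv_mul_cancel, permCoord_one, Set.image_id]

/-- The action of `S_k` on `G^k` by permuting the components. -/
def permuteFactors (G : Type*) [Group G] (k : ℕ) :
    Equiv.Perm (Fin k) →* MulAut (Fin k → G) where
  toFun π :=
    { toFun := fun g i => g (π⁻¹ i)
      invFun := fun g i => g (π i)
      left_inv := by intro g; funext i; simp
      right_inv := by intro g; funext i; simp
      map_mul' := by intro g h; rfl }
  map_one' := by ext g i; rfl
  map_mul' := by intro π ρ; ext g i; simp [mul_inv_rev]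

/-- The wreath product `G ≀ S_k = G^k ⋊ S_k`. -/
abbrev Wreath (G : Type*) [Group G] (k : ℕ) : Type _ :=
  (Fin k → G) ⋊[permuteFactors G k] Equiv.Perm (Fin k)

/-- The levels other than level `1`. -/
abbrev NonOne (s : ℕ) [NeZero s] : Type := {a : Fin s // a ≠ 0}

/-- `(g, π)` sends `x` to the combination obtained by moving factor `i` to position `π i` and then
relabelling the levels different from `1` in each factor `j` by `g j` (level `1` is fixed). -/
def wreathAct {k s : ℕ} [NeZero s] (w : Wreath (Equiv.Perm (NonOne s)) k)
    (x : Comb k s) : Comb k s :=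
  fun i => Equiv.Perm.ofSubtype (w.left i) (x (w.right⁻¹ i))

theorem wreathAct_one {k s : ℕ} [NeZero s] (x : Comb k s) :
    wreathAct (1 : Wreath (Equiv.Perm (NonOne s)) k) x = x := by
  funext i
  simp [wreathAct]

theorem wreathAct_mul {k s : ℕ} [NeZero s] (w v : Wreath (Equiv.Perm (NonOne s)) k)
    (x : Comb k s) : wreathAct (w * v) x = wreathAct w (wreathAct v x) := by
  funext i
  simp [wreathAct, permuteFactors, mul_inv_rev]

theorem dist1_wreathAct {k s : ℕ} [NeZero s] (w : Wreath (Equiv.Perm (NonOne s)) k)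
    (x : Comb k s) : dist1 (wreathAct w x) = dist1 x := by
  have key : ∀ (g : Equiv.Perm (NonOne s)) (a : Fin s),
      (0 = Equiv.Perm.ofSubtype g a) ↔ 0 = a := by
    intro g a
    have h0 : Equiv.Perm.ofSubtype g (0 : Fin s) = 0 :=
      Equiv.Perm.ofSubtype_apply_of_not_mem g (by simp)
    constructor
    · intro h
      exact (Equiv.Perm.ofSubtype g).injective (h0.trans h)
    · rintro rfl
      exact h0.symm
  unfold dist1 hammingDist
  refine Finset.card_bij' (fun i _ => w.right⁻¹ i) (fun i _ => w.right i) ?_ ?_ ?_ ?_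
  · intro i hi
    simpa [wreathAct, key] using hi
  · intro i hi
    simpa [wreathAct, key] using hi
  · intro i _; simp
  · intro i _; simp

/-- The natural homomorphism from `S_{s-1} ≀ S_k` to the permutations of the index set of the
variables. -/
def wreathHom (k s t : ℕ) [NeZero s] :
    Wreath (Equiv.Perm (NonOne s)) k →* Equiv.Perm (VarIdx k s t) where
  toFun w :=
    { toFun := fun y => ⟨wreathAct w y.1, by rw [dist1_wreathAct]; exact y.2⟩
      invFun := fun y => ⟨wreathAct w⁻¹ y.1, by rw [dist1_wreathAct]; exact y.2⟩
      left_inv := by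
        intro y
        apply Subtype.ext
        simp only [← wreathAct_mul, inv_mul_cancel, wreathAct_one]
      right_inv := by
        intro y
        apply Subtype.ext
        simp only [← wreathAct_mul, mul_inv_cancel, wreathAct_one] }
  map_one' := by
    ext y : 2
    exact wreathAct_one y.1
  map_mul' := by
    intro w v
    ext y : 2
    exact wreathAct_mul w v y.1

/-- The group `H_{k,s,t}`, as a group of permutations of the index set of the variables: the full
symmetric group if `t = 0`; the permutations induced by `S_{s-1} ≀ S_k` if `0 < t < k` and
(`k > t + 1` or `s > 2`); the trivial group otherwise. -/
def HGroup (k s t : ℕ) [NeZero s] : Subgroup (Equiv.Perm (VarIdx k s t)) :=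
  if t = 0 then ⊤
  else if t < k ∧ (t + 1 < k ∨ 2 < s) then (wreathHom k s t).range
  else ⊥

end OAPoly

/-! Take a function `F` on all of `[s]^k` whose `t`-margins all equal `lam`, and eliminate the
values `F x` with `d(1,x) ≤ t` through the margin equations. What results for `F x` is the left-hand
side of the inequality at `x`. So every defining inequality, whether indexed by `Y` or by an `x`
outside it, is nonnegativity of one value of `F`.

Suppose `t < k`, and `t + 1 < k` or `2 < s`. Subtracting from a constant function a multiple of the
projection of the indicator of `z` to the functions with zero `t`-margins gives a function that
vanishes at `z` only (`facetPoint`, `ineqLHS_facetPoint`). Hence the inequality of `z` can be tight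
alone, and defines a facet. A coordinate symmetry permutes facets, so it permutes the supports of
their functionals (`exists_support_image`), in particular the sets `J_x ∩ Y` with `d(1,x) ≤ t`
(`exists_inJ_image`). Inclusion of these sets reverses the order `InJ`, so for `t > 0` the largest
proper ones are the level sets `y i = a` with `a ≠ 0`. A permutation of `Y` that permutes the level
sets comes from the wreath product (`mem_range_wreathHom_of_level_image`); conversely the wreath
product preserves the inequalities.

For `t = 0` the only inequality besides nonnegativity is symmetric in all coordinates. In the
remaining cases `Y` has at most one element. -/

open scoped BigOperators

namespace OAPoly

/-! ### Alternating binomial weights and a closed form for the sequence `a_c` -/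

/-- The weights `(-1) ^ c * C(j - 1, c)`, where the binomial coefficient is read as a polynomial
in `j`. -/
def altWeight (c : ℕ) : ℕ → ℝ
  | 0 => 1
  | j + 1 => (-1) ^ c * (j.choose c : ℝ)

theorem altWeight_zero_succ (j : ℕ) : altWeight 0 (j + 1) = altWeight 0 j := by
  cases j <;> simp [altWeight]

theorem altWeight_succ_succ (c j : ℕ) :
    altWeight (c + 1) (j + 1) = altWeight (c + 1) j - altWeight c j := by
  cases j with
  | zero => simp [altWeight]
  | succ j =>
    simp only [altWeight, Nat.choose_succ_succ, Nat.cast_add]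
    ring

theorem altWeight_eq_zero {c j : ℕ} (h0 : j ≠ 0) (hj : j ≤ c) : altWeight c j = 0 := by
  obtain ⟨j, rfl⟩ := Nat.exists_eq_succ_of_ne_zero h0
  simp [altWeight, Nat.choose_eq_zero_of_lt (show j < c by omega)]

open Polynomial

/-- The linear functional on polynomials with `X ^ j ↦ altWeight c j`. -/
noncomputable def altFunctional (c : ℕ) : ℝ[X] →ₗ[ℝ] ℝ :=
  Polynomial.lsum fun j => altWeight c j • LinearMap.id

theorem altFunctional_monomial (c j : ℕ) (a : ℝ) :
    altFunctional c (monomial j a) = altWeight c j * a := by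
  simp [altFunctional, Polynomial.lsum_apply, Polynomial.sum_monomial_index]

/-- Pascal's rule for the weights. The consequences below identify `altFunctional c p` as the
constant term of the remainder of `p` modulo `(1 - X) ^ (c + 1)`. -/
theorem altFunctional_succ_one_sub_X_mul (c : ℕ) (p : ℝ[X]) :
    altFunctional (c + 1) ((1 - X) * p) = altFunctional c p := by
  induction p using Polynomial.induction_on' with
  | add p q hp hq => rw [mul_add, map_add, map_add, hp, hq]
  | monomial j a =>
    rw [sub_mul, one_mul, X_mul_monomial, map_sub, altFunctional_monomial,
      altFunctional_monomial, altFunctional_monomial, altWeight_succ_succ]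
    ring

theorem altFunctional_zero_one_sub_X_mul (p : ℝ[X]) :
    altFunctional 0 ((1 - X) * p) = 0 := by
  induction p using Polynomial.induction_on' with
  | add p q hp hq => rw [mul_add, map_add, hp, hq, add_zero]
  | monomial j a =>
    rw [sub_mul, one_mul, X_mul_monomial, map_sub, altFunctional_monomial,
      altFunctional_monomial, altWeight_zero_succ, sub_self]

theorem altFunctional_one_sub_X_pow_mul (c m : ℕ) (p : ℝ[X]) :
    altFunctional (c + m) ((1 - X) ^ m * p) = altFunctional c p := by
  induction m with
  | zero => simp
  | succ m ih =>
    rw [pow_succ', mul_assoc, ← add_assoc, altFunctional_succ_one_sub_X_mul, ih]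

theorem altFunctional_one_sub_X_pow_mul_eq_zero {c m : ℕ} (h : c < m) (p : ℝ[X]) :
    altFunctional c ((1 - X) ^ m * p) = 0 := by
  obtain ⟨r, rfl⟩ := Nat.exists_eq_add_of_lt h
  have := altFunctional_one_sub_X_pow_mul 0 c ((1 - X) * ((1 - X) ^ r * p))
  rw [altFunctional_zero_one_sub_X_mul, zero_add] at this
  rw [← this]
  congr 1
  ring

theorem altFunctional_of_natDegree_le {c : ℕ} {p : ℝ[X]} (h : p.natDegree ≤ c) :
    altFunctional c p = p.coeff 0 := by
  conv_lhs => rw [p.as_sum_range' (c + 1) (by omega), map_sum, Finset.sum_range_succ']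
  rw [Finset.sum_eq_zero]
  · rw [zero_add, altFunctional_monomial, altWeight, one_mul]
  · intro j hj
    rw [altFunctional_monomial, altWeight_eq_zero (by omega) (by simpa using hj), zero_mul]

/-- Evaluate `altFunctional c` on `(1 + r) ^ q * (1 + r X) ^ c` after expanding `1 + r = r (1 - X) +
(1 + r X)` binomially. With `q = k - t` and `r = s - 1` this is the recursion for `aSeq`, up to
scaling. -/
theorem sum_choose_mul_altFunctional (q c : ℕ) (r : ℝ) :
    ∑ m ∈ Finset.range (c + 1), (q.choose m : ℝ) * r ^ m *
      altFunctional (c - m) ((1 + C r * X) ^ (q + (c - m))) = (1 + r) ^ q := by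
  have key : ((C r * (1 - X) + (1 + C r * X)) ^ q * (1 + C r * X) ^ c : ℝ[X]) =
      (1 + r) ^ q • (1 + C r * X) ^ c := by
    rw [smul_eq_C_mul, C_pow, C_add, C_1]
    congr 2
    ring
  have h1 : altFunctional c ((1 + r) ^ q • (1 + C r * X) ^ c) = (1 + r) ^ q := by
    rw [map_smul, altFunctional_of_natDegree_le]
    · simp [coeff_zero_eq_eval_zero]
    · refine natDegree_pow_le_of_le (m := 1) c ?_ |>.trans (by simp)
      compute_degree
  rw [← h1, ← key, add_pow, Finset.sum_mul, map_sum]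
  have hf : ∀ m ∈ Finset.range (q + 1),
      altFunctional c ((C r * (1 - X)) ^ m * (1 + C r * X) ^ (q - m) * (q.choose m : ℝ[X]) *
        (1 + C r * X) ^ c) = (q.choose m : ℝ) * r ^ m *
        altFunctional c ((1 - X) ^ m * (1 + C r * X) ^ (q + c - m)) := by
    intro m hm
    have hm : m ≤ q := by simpa [Nat.lt_succ_iff] using hm
    rw [← smul_eq_mul (a := (q.choose m : ℝ) * r ^ m), ← map_smul, smul_eq_C_mul]
    congr 1
    rw [show q + c - m = (q - m) + c by omega, pow_add, mul_pow]
    simp only [map_mul, map_pow, map_natCast]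
    ring
  rw [Finset.sum_congr rfl hf]
  -- Both sums are extended to `range (q + c + 1)`: terms with `m > q` have zero binomial
  -- coefficient, and terms with `m > c` are killed by the functional.
  rw [Finset.sum_subset (Finset.range_mono (show q + 1 ≤ q + c + 1 by omega))]
  · symm
    rw [← Finset.sum_subset (Finset.range_mono (show c + 1 ≤ q + c + 1 by omega))]
    · refine Finset.sum_congr rfl fun m hm => ?_
      have hm : m ≤ c := by simpa [Nat.lt_succ_iff] using hm
      have := altFunctional_one_sub_X_pow_mul (c - m) m ((1 + C r * X) ^ (q + (c - m)))
      rw [Nat.sub_add_cancel hm] at this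
      rw [← this, Nat.add_sub_assoc hm]
    · intro m _ hm
      rw [altFunctional_one_sub_X_pow_mul_eq_zero (by simpa using hm), mul_zero]
  · intro m _ hm
    rw [Nat.choose_eq_zero_of_lt (by simpa using hm)]
    simp

theorem aSeq_eq_altFunctional (k s t lam : ℕ) [NeZero s] (c : ℕ) :
    (aSeq k s t lam c : ℝ) = lam / (s : ℝ) ^ (k - t) *
      altFunctional c ((1 + C ((s : ℝ) - 1) * X) ^ (k - t + c)) := by
  induction c using Nat.strong_induction_on with
  | _ c ih =>
    have hs : (s : ℝ) ^ (k - t) ≠ 0 := pow_ne_zero _ (NeZero.ne _)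
    have h := sum_choose_mul_altFunctional (k - t) c ((s : ℝ) - 1)
    rw [← Finset.sum_range_reflect, Finset.sum_range_succ] at h
    rw [add_sub_cancel] at h
    rw [aSeq]
    push_cast
    rw [Finset.sum_congr rfl fun e _ => by rw [ih e.1 e.2],
      Fin.sum_univ_eq_sum_range (fun e => (lam / (s : ℝ) ^ (k - t) *
      altFunctional e ((1 + C ((s : ℝ) - 1) * X) ^ (k - t + e))) *
        ((k - t).choose (c - e) : ℝ) * ((s : ℝ) - 1) ^ (c - e)) c]
    have h2 : (lam : ℝ) = lam / (s : ℝ) ^ (k - t) * (s : ℝ) ^ (k - t) := by field_simp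
    generalize (lam : ℝ) / (s : ℝ) ^ (k - t) = ν at *
    rw [h2, ← h, mul_add, Finset.mul_sum]
    simp only [add_tsub_cancel_right, tsub_self, tsub_zero, Nat.choose_zero_right, Nat.cast_one,
      pow_zero, one_mul]
    rw [sub_eq_iff_eq_add, add_comm, add_right_inj]
    refine Finset.sum_congr rfl fun e he => ?_
    rw [Nat.sub_sub_self (Finset.mem_range.1 he).le]
    ring

/-! ### Generating polynomials over `J_x` -/

section Combinations

variable {k s : ℕ} [NeZero s]

theorem dist1_eq_card (x : Comb k s) : dist1 x = (Finset.univ.filter fun i => x i ≠ 0).card := by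
  simp [dist1, hammingDist, ne_comm]

theorem dist1_le (x : Comb k s) : dist1 x ≤ k := by
  rw [dist1_eq_card]
  exact (Finset.card_filter_le _ _).trans (by simp)

theorem dist1_eq_of_forall_ne_zero {y : Comb k s} (h : ∀ i, y i ≠ 0) : dist1 y = k := by
  simp [dist1_eq_card, h]

theorem InJ.dist1_eq {x y : Comb k s} (h : InJ x y) :
    dist1 y = dist1 x + (Finset.univ.filter fun i => x i = 0 ∧ y i ≠ 0).card := by
  rw [dist1_eq_card, dist1_eq_card, ← Finset.card_union_of_disjoint]
  · congr 1
    ext i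
    have := h i
    simp only [Finset.mem_filter, Finset.mem_univ, true_and, Finset.mem_union]
    by_cases hx : x i = 0 <;> simp_all
  · rw [Finset.disjoint_filter]
    tauto

theorem InJ.dist1_lt {x y : Comb k s} (h : InJ x y) (hne : y ≠ x) : dist1 x < dist1 y := by
  rw [h.dist1_eq]
  obtain ⟨i, hi⟩ := Function.ne_iff.1 hne
  have hx : x i = 0 := by
    by_contra hx
    exact hi (h i hx)
  have : 0 < (Finset.univ.filter fun i => x i = 0 ∧ y i ≠ 0).card :=
    Finset.card_pos.2 ⟨i, by simpa [hx] using hx ▸ hi⟩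
  omega

/-- The generating polynomial of `F` over `J_x`, by distance from `x`. -/
noncomputable def genPoly (x : Comb k s) (F : Comb k s → ℝ) : ℝ[X] :=
  ∑ y with InJ x y, monomial (dist1 y - dist1 x) (F y)

theorem altFunctional_genPoly (c : ℕ) (x : Comb k s) (F : Comb k s → ℝ) :
    altFunctional c (genPoly x F) =
      ∑ y with InJ x y, altWeight c (dist1 y - dist1 x) * F y := by
  simp [genPoly, altFunctional_monomial]

/-- The weights vanish at distances `1, …, t - d(1,x)`, so among the `y` outside `Y` only `x`
contributes, with weight `1`. The left-hand side thus equals `F x` as soon as the functional takes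
the value `aSeq`. -/
theorem ineqLHS_restrict (t lam : ℕ) {x : Comb k s} (hx : dist1 x ≤ t) (F : Comb k s → ℝ) :
    ineqLHS t lam x (fun y => F y.1) =
      aSeq k s t lam (t - dist1 x) + F x - altFunctional (t - dist1 x) (genPoly x F) := by
  have hY : ∑ y : VarIdx k s t with InJ x y.1,
        ((dist1 y.1 - dist1 x - 1).choose (t - dist1 x) : ℝ) * F y.1 =
      ∑ y ∈ (Finset.univ.filter fun y => InJ x y) with t < dist1 y,
        ((dist1 y - dist1 x - 1).choose (t - dist1 x) : ℝ) * F y := by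
    rw [Finset.filter_filter, Finset.sum_filter]
    simp_rw [and_comm (a := InJ x _)]
    rw [← Finset.filter_filter, Finset.sum_filter (p := InJ x),
      Finset.sum_subtype _ (p := fun y : Comb k s => t < dist1 y) (by simp)]
  rw [altFunctional_genPoly, ineqLHS, hY,
    ← Finset.sum_filter_add_sum_filter_not (Finset.univ.filter fun y => InJ x y)
      (fun y => t < dist1 y)]
  rw [Finset.sum_eq_single (s := Finset.filter (fun y => ¬ t < dist1 y) _) x]
  · rw [tsub_self, altWeight, one_mul]
    have : ∑ y ∈ (Finset.univ.filter fun y => InJ x y) with t < dist1 y,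
        altWeight (t - dist1 x) (dist1 y - dist1 x) * F y = (-1) ^ (t - dist1 x) *
      ∑ y ∈ (Finset.univ.filter fun y => InJ x y) with t < dist1 y,
        ((dist1 y - dist1 x - 1).choose (t - dist1 x) : ℝ) * F y := by
      rw [Finset.mul_sum]
      refine Finset.sum_congr rfl fun y hy => ?_
      have hy : t < dist1 y := (Finset.mem_filter.1 hy).2
      obtain ⟨m, hm⟩ : ∃ m, dist1 y - dist1 x = m + 1 := ⟨dist1 y - dist1 x - 1, by omega⟩
      rw [hm, Nat.add_sub_cancel]
      simp only [altWeight, mul_assoc]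
    rw [this]
    ring
  · intro y hy hne
    simp only [Finset.mem_filter, Finset.mem_univ, true_and, not_lt] at hy
    have := hy.1.dist1_lt hne
    rw [altWeight_eq_zero (by omega) (by omega), zero_mul]
  · intro h
    refine absurd ?_ h
    simp only [Finset.mem_filter, Finset.mem_univ, true_and, not_lt]
    exact ⟨fun _ _ => rfl, hx⟩

/-- `J_x` is a product set and distance from `x` is additive over coordinates. The form of the
factors shows that a mean-zero `h i` at a free coordinate contributes a multiple of `1 - X`. -/
theorem genPoly_prod (x : Comb k s) (h : Fin k → Fin s → ℝ) :
    genPoly x (fun y => ∏ i, h i (y i)) =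
      ∏ i, if x i = 0 then C (h i 0) * (1 - X) + C (∑ a, h i a) * X else C (h i (x i)) := by
  have hJ : (Finset.univ.filter fun y => InJ x y) =
      Fintype.piFinset fun i => Finset.univ.filter fun a => x i ≠ 0 → a = x i := by
    ext y
    rw [Finset.mem_filter]
    simp [InJ]
  have hfac : ∀ i, (if x i = 0 then C (h i 0) * (1 - X) + C (∑ a, h i a) * X
      else C (h i (x i)) : ℝ[X]) = ∑ a with (x i ≠ 0 → a = x i),
        C (h i a) * (if x i = 0 ∧ a ≠ 0 then X else 1) := by
    intro i
    split_ifs with hi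
    · simp only [hi, ne_eq, not_true_eq_false, false_imp_iff, Finset.filter_true, true_and]
      rw [← Finset.add_sum_erase _ _ (Finset.mem_univ (0 : Fin s)),
        ← Finset.add_sum_erase _ _ (Finset.mem_univ (0 : Fin s)), C_add, map_sum, add_mul,
        Finset.sum_mul, if_neg (by simp), ← add_assoc]
      congr 1
      · ring
      · refine Finset.sum_congr rfl fun a ha => ?_
        rw [if_pos (Finset.ne_of_mem_erase ha)]
    · simp [hi, Finset.filter_eq']
  rw [Finset.prod_congr rfl fun i _ => hfac i, Finset.prod_univ_sum, ← hJ, genPoly]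
  refine Finset.sum_congr rfl fun y hy => ?_
  have hy : InJ x y := (Finset.mem_filter.1 hy).2
  rw [Finset.prod_mul_distrib, Finset.prod_ite, hy.dist1_eq, Nat.add_sub_cancel_left]
  simp [C_mul_X_pow_eq_monomial, ← map_prod]

theorem genPoly_const (x : Comb k s) (r : ℝ) :
    genPoly x (fun _ => r) = r • (1 + C ((s : ℝ) - 1) * X) ^ (k - dist1 x) := by
  have h1 := genPoly_prod x fun _ _ => 1
  have hc : (Finset.univ.filter fun i => x i = 0).card = k - dist1 x := by
    have := Finset.card_filter_add_card_filter_not (s := Finset.univ) (fun i => x i = 0)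
    rw [dist1_eq_card]
    simp only [Finset.card_univ, Fintype.card_fin, ne_eq] at this ⊢
    omega
  have h2 : genPoly x (fun _ => r) = r • genPoly x (fun _ => 1) := by
    simp [genPoly, Finset.smul_sum, smul_monomial]
  rw [h2]
  simp only [Finset.prod_const_one] at h1
  rw [h1, Finset.prod_ite, Finset.prod_const, hc]
  simp only [map_one, Finset.prod_const_one, mul_one]
  congr 2
  simp
  ring

/-- The product over `i ∈ S` of the mean-zero functions `s * [y_i = z_i] - 1`. -/
noncomputable def charProd {k s : ℕ} (z : Comb k s) (S : Finset (Fin k)) (y : Comb k s) : ℝ :=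
  ∏ i, if i ∈ S then (if y i = z i then (s : ℝ) - 1 else -1) else 1

/-- At most `d(1,x)` coordinates of `S` are fixed by `x`; each of the others, more than `t - d(1,x)`
in number, gives a factor `1 - X`. -/
theorem altFunctional_genPoly_charProd {t : ℕ} {x : Comb k s} (hx : dist1 x ≤ t) (z : Comb k s)
    {S : Finset (Fin k)} (hS : t < S.card) :
    altFunctional (t - dist1 x) (genPoly x (charProd z S)) = 0 := by
  have h := genPoly_prod x fun i a => if i ∈ S then (if a = z i then (s : ℝ) - 1 else -1) else 1
  change genPoly x (charProd z S) = _ at h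
  set T := S.filter fun i => x i = 0
  have hT : t - dist1 x < T.card := by
    have h1 := Finset.card_filter_add_card_filter_not (s := S) (fun i => x i = 0)
    have h2 : (S.filter fun i => ¬ x i = 0).card ≤ dist1 x := by
      rw [dist1_eq_card]
      exact Finset.card_le_card (Finset.filter_subset_filter _ (Finset.subset_univ _))
    change _ < (S.filter fun i => x i = 0).card
    omega
  rw [h, ← Finset.prod_mul_prod_compl T, Finset.prod_congr
    (g := fun i => (1 - X) * C (if 0 = z i then (s : ℝ) - 1 else -1)) rfl,
    Finset.prod_mul_distrib, Finset.prod_const, mul_assoc,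
    altFunctional_one_sub_X_pow_mul_eq_zero hT]
  intro i hi
  obtain ⟨hiS, hi0⟩ := Finset.mem_filter.1 hi
  have hsum : ∑ a : Fin s, (if a = z i then (s : ℝ) - 1 else -1) = 0 := by
    rw [Finset.sum_ite, Finset.sum_const, Finset.sum_const, Finset.filter_eq', Finset.filter_ne',
      if_pos (Finset.mem_univ _), Finset.card_erase_of_mem (Finset.mem_univ _)]
    have : 1 ≤ s := NeZero.one_le
    simp [Nat.cast_sub this]
  simp only [hi0, if_true, hiS, hsum]
  simp
  ring

end Combinations

/-! ### Coordinate symmetries and facets of a polyhedron -/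

section Facets

theorem permCoord_mem_iff {ι : Type*} {P : Set (ι → ℝ)} {σ : Equiv.Perm ι} (hσ : σ ∈ permSymm P)
    (v : ι → ℝ) : permCoord σ v ∈ P ↔ v ∈ P := by
  have hσ : permCoord σ '' P = P := hσ
  have hinj : Function.Injective (permCoord σ) := fun v w h => by
    funext i
    simpa [permCoord] using congrFun h (σ i)
  conv_lhs => rw [← hσ]
  exact hinj.mem_set_image

theorem dotProduct_permCoord {ι : Type*} [Fintype ι] (a : ι → ℝ) (σ : Equiv.Perm ι) (v : ι → ℝ) :
    dotProduct a (permCoord σ v) = dotProduct (a ∘ σ) v := by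
  simp only [dotProduct, permCoord]
  rw [← Equiv.sum_comp σ]
  simp

theorem permCoord_add_smul {ι : Type*} (σ : Equiv.Perm ι) (p v : ι → ℝ) (ε : ℝ) :
    permCoord σ (p + ε • v) = permCoord σ p + ε • permCoord σ v := rfl

variable {ι κ : Type*} [Fintype ι] [Finite κ]

theorem exists_pos_add_smul_mem {b : κ → ℝ} {A : κ → ι → ℝ} {q v : ι → ℝ}
    (hq : ∀ w, 0 ≤ b w + dotProduct (A w) q)
    (hv : ∀ w, b w + dotProduct (A w) q = 0 → 0 ≤ dotProduct (A w) v) :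
    ∃ ε : ℝ, 0 < ε ∧ ∀ w, 0 ≤ b w + dotProduct (A w) (q + ε • v) := by
  have h : ∀ᶠ ε in nhdsWithin (0 : ℝ) (Set.Ioi 0),
      ∀ w, 0 ≤ b w + dotProduct (A w) (q + ε • v) := by
    rw [Filter.eventually_all]
    intro w
    simp only [dotProduct_add, dotProduct_smul, smul_eq_mul]
    rcases (hq w).eq_or_lt' with h0 | h0
    · filter_upwards [self_mem_nhdsWithin] with ε hε
      rw [← add_assoc, h0, zero_add]
      exact mul_nonneg (le_of_lt hε) (hv w h0)
    · have hc : Filter.Tendsto (fun ε : ℝ => b w + (dotProduct (A w) q + ε * dotProduct (A w) v))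
          (nhdsWithin 0 (Set.Ioi 0)) (nhds (b w + (dotProduct (A w) q + 0 * dotProduct (A w) v))) :=
        (Continuous.tendsto (by fun_prop) 0).mono_left nhdsWithin_le_nhds
      rw [zero_mul, add_zero] at hc
      exact (hc.eventually (lt_mem_nhds h0)).mono fun ε hε => hε.le
  obtain ⟨ε, h1, h2⟩ := (h.and self_mem_nhdsWithin).exists
  exact ⟨ε, h2, h1⟩

/-- A coordinate symmetry of a polyhedron sends a facet to a facet, hence the support of a
facet-defining functional to the support of a defining functional. -/
theorem exists_support_image {b : κ → ℝ} {A : κ → ι → ℝ} {P : Set (ι → ℝ)}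
    (hP : ∀ N, N ∈ P ↔ ∀ w, 0 ≤ b w + dotProduct (A w) N) (hA : ∀ w, ∃ y, A w y ≠ 0)
    {σ : Equiv.Perm ι} (hσ : σ ∈ permSymm P) {x : κ} {p : ι → ℝ}
    (hx : b x + dotProduct (A x) p = 0) (hp : ∀ w, w ≠ x → 0 < b w + dotProduct (A w) p) :
    ∃ w, b w + dotProduct (A w) (permCoord σ p) = 0 ∧ ∀ y, A x y ≠ 0 ↔ A w (σ y) ≠ 0 := by
  classical
  have hpP : ∀ w, 0 ≤ b w + dotProduct (A w) p := fun w => by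
    by_cases h : w = x
    · rw [h, hx]
    · exact (hp w h).le
  have hσp : ∀ w, 0 ≤ b w + dotProduct (A w) (permCoord σ p) := by
    rwa [← hP, permCoord_mem_iff hσ, hP]
  obtain ⟨w, hw⟩ : ∃ w, b w + dotProduct (A w) (permCoord σ p) = 0 := by
    -- If nothing were tight at the image of `p`, every direction would be feasible there, including
    -- one that decreases the functional of `x`, which is already zero at `p`.
    by_contra! hne
    obtain ⟨y, hy⟩ := hA x
    obtain ⟨ε, hε, h⟩ := exists_pos_add_smul_mem hσp (v := permCoord σ (Pi.single y (-A x y)))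
      fun w hw => absurd hw (hne w)
    rw [← permCoord_add_smul, ← hP, permCoord_mem_iff hσ, hP] at h
    have h := h x
    rw [dotProduct_add, ← add_assoc, hx, dotProduct_smul, dotProduct_single, smul_eq_mul] at h
    have := mul_pos hε (mul_self_pos.2 hy)
    linarith
  refine ⟨w, hw, ?_⟩
  -- Only `x` is tight at `p`, so small moves inside its hyperplane stay in `P`. Applied to `v` and
  -- `-v`, this makes `A w ∘ σ` vanish on the kernel of `A x`; the two nonzero functionals are then
  -- proportional.
  have hnn : ∀ v, dotProduct (A x) v = 0 → 0 ≤ dotProduct (A w ∘ σ) v := by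
    intro v hv
    obtain ⟨ε, hε, h⟩ := exists_pos_add_smul_mem hpP (v := v) fun u hu => by
      by_cases hux : u = x
      · rw [hux, hv]
      · exact absurd hu (hp u hux).ne'
    rw [← hP, ← permCoord_mem_iff hσ, hP] at h
    have h := h w
    rw [permCoord_add_smul, dotProduct_add, ← add_assoc, hw, dotProduct_smul, smul_eq_mul,
      zero_add, dotProduct_permCoord] at h
    exact nonneg_of_mul_nonneg_right h hε
  have hker : ∀ v, dotProduct (A x) v = 0 → dotProduct (A w ∘ σ) v = 0 := by
    intro v hv
    refine le_antisymm ?_ (hnn v hv)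
    have := hnn (-v) (by rw [dotProduct_neg, hv, neg_zero])
    rwa [dotProduct_neg, neg_nonneg] at this
  have h1 : ∀ y, A w (σ y) ≠ 0 → A x y ≠ 0 := by
    intro y hy h0
    have := hker (Pi.single y 1) (by simp [h0])
    simp at this
    exact hy this
  refine fun y => ⟨fun hy h0 => ?_, h1 y⟩
  obtain ⟨u, hu⟩ := hA w
  have hu' : A w (σ (σ⁻¹ u)) ≠ 0 := by simpa using hu
  have := hker (Pi.single y (A x (σ⁻¹ u)) - Pi.single (σ⁻¹ u) (A x y))
    (by simp [dotProduct_sub, mul_comm])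
  simp [dotProduct_sub, h0] at this
  exact this.elim hu hy

end Facets

/-! ### Points at which exactly one inequality is tight -/

section FacetPoints

variable {k s t : ℕ}

theorem charProd_self (z : Comb k s) (S : Finset (Fin k)) :
    charProd z S z = ((s : ℝ) - 1) ^ S.card := by
  simp [charProd, Finset.prod_ite_mem]

theorem charProd_univ {z y : Comb k s} {i : Fin k} (hi : y i ≠ z i) :
    charProd z Finset.univ y = -charProd z (Finset.univ.erase i) y := by
  rw [charProd, charProd, ← Finset.mul_prod_erase _ _ (Finset.mem_univ i),
    ← Finset.mul_prod_erase (Finset.univ) (fun j => if j ∈ Finset.univ.erase i then _ else _)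
      (Finset.mem_univ i)]
  simp only [hi, Finset.mem_univ, if_true, if_false, Finset.notMem_erase]
  rw [one_mul, neg_one_mul, neg_inj]
  refine Finset.prod_congr rfl fun j hj => ?_
  rw [if_pos hj]

theorem abs_charProd_le (hs : 2 ≤ s) (z : Comb k s) (S : Finset (Fin k)) (y : Comb k s) :
    |charProd z S y| ≤ ((s : ℝ) - 1) ^ S.card := by
  have hs' : (2 : ℝ) ≤ s := by exact_mod_cast hs
  rw [← charProd_self z S, charProd, charProd, Finset.abs_prod]
  refine Finset.prod_le_prod (fun _ _ => abs_nonneg _) fun i _ => ?_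
  by_cases hi : i ∈ S
  · by_cases hy : y i = z i
    · simp only [hi, hy, if_true]
      rw [abs_of_nonneg (by linarith)]
    · simp only [hi, hy, if_true, if_false, abs_neg, abs_one]
      linarith
  · simp [hi]

/-- The sum of `charProd z S` over `|S| > t`, a scalar multiple of the orthogonal projection of the
indicator of `z` to the functions with vanishing `t`-margins. -/
noncomputable def kernelSum (t : ℕ) (z y : Comb k s) : ℝ :=
  ∑ S : Finset (Fin k) with t < S.card, charProd z S y

theorem kernelSum_self_pos (hs : 2 ≤ s) (htk : t < k) (z : Comb k s) : 0 < kernelSum t z z := by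
  have hs' : (2 : ℝ) ≤ s := by exact_mod_cast hs
  refine Finset.sum_pos (fun S _ => ?_) ⟨Finset.univ, by simpa using htk⟩
  rw [charProd_self]
  exact pow_pos (by linarith) _

/-- Every summand is maximal at `z`. If the summand of the full set is also maximal at `y`, deleting
a coordinate where `y` and `z` differ flips its sign: for `t + 1 < k` the smaller set is itself a
summand and is strict, and for `2 < s` its absolute value would exceed the bound. -/
theorem kernelSum_lt (hs : 2 ≤ s) (htk : t < k) (h : t + 1 < k ∨ 2 < s) {z y : Comb k s}
    (hyz : y ≠ z) : kernelSum t z y < kernelSum t z z := by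
  have hs' : (2 : ℝ) ≤ s := by exact_mod_cast hs
  have hle : ∀ S, charProd z S y ≤ charProd z S z := fun S => by
    rw [charProd_self]
    exact (le_abs_self _).trans (abs_charProd_le hs z S y)
  obtain ⟨i, hi⟩ := Function.ne_iff.1 hyz
  have hu := charProd_univ hi
  have hcard : (Finset.univ.erase i).card = k - 1 := by simp
  refine Finset.sum_lt_sum (fun S _ => hle S) ?_
  by_cases hlt : charProd z Finset.univ y < charProd z Finset.univ z
  · exact ⟨Finset.univ, by simpa using htk, hlt⟩
  have heq : charProd z (Finset.univ.erase i) y = -((s : ℝ) - 1) ^ k := by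
    have := (hle Finset.univ).antisymm (not_lt.1 hlt)
    rw [hu, charProd_self, Finset.card_univ, Fintype.card_fin] at this
    linarith
  have hk : ((s : ℝ) - 1) ^ k = (s - 1) * (s - 1) ^ (k - 1) := by
    rw [← pow_succ']
    congr 1
    omega
  have hpos : 0 < ((s : ℝ) - 1) ^ (k - 1) := pow_pos (by linarith) _
  rcases h with h | h
  · refine ⟨Finset.univ.erase i, by simp; omega, ?_⟩
    rw [charProd_self, hcard, heq, hk]
    nlinarith
  · exfalso
    have hs3 : (3 : ℝ) ≤ s := by exact_mod_cast h
    have := abs_charProd_le hs z (Finset.univ.erase i) y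
    rw [heq, abs_neg, hcard, hk, abs_of_pos (mul_pos (by linarith) hpos)] at this
    nlinarith

/-- A point of the polytope, extended to all combinations, that vanishes exactly at `z`. -/
noncomputable def facetPoint (t lam : ℕ) (z y : Comb k s) : ℝ :=
  lam / (s : ℝ) ^ (k - t) * (1 - kernelSum t z y / kernelSum t z z)

theorem facetPoint_self (hs : 2 ≤ s) (htk : t < k) (lam : ℕ) (z : Comb k s) :
    facetPoint t lam z z = 0 := by
  rw [facetPoint, div_self (kernelSum_self_pos hs htk z).ne', sub_self, mul_zero]

theorem facetPoint_pos (hs : 2 ≤ s) (htk : t < k) (h : t + 1 < k ∨ 2 < s) {lam : ℕ}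
    (hlam : 0 < lam) {z y : Comb k s} (hyz : y ≠ z) : 0 < facetPoint t lam z y := by
  have hs' : (0 : ℝ) < s := by exact_mod_cast (by omega : 0 < s)
  refine mul_pos (div_pos (by exact_mod_cast hlam) (pow_pos hs' _)) ?_
  rw [sub_pos, div_lt_one (kernelSum_self_pos hs htk z)]
  exact kernelSum_lt hs htk h hyz

theorem ineqLHS_facetPoint [NeZero s] (htk : t < k) (lam : ℕ) (z : Comb k s) {x : Comb k s}
    (hx : dist1 x ≤ t) :
    ineqLHS t lam x (fun y => facetPoint t lam z y.1) = facetPoint t lam z x := by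
  rw [ineqLHS_restrict t lam hx]
  suffices h : altFunctional (t - dist1 x) (genPoly x (facetPoint t lam z)) =
      aSeq k s t lam (t - dist1 x) by
    rw [h]
    ring
  have hker : altFunctional (t - dist1 x) (genPoly x (kernelSum t z)) = 0 := by
    have : altFunctional (t - dist1 x) (genPoly x (kernelSum t z)) =
        ∑ S : Finset (Fin k) with t < S.card,
          altFunctional (t - dist1 x) (genPoly x (charProd z S)) := by
      simp only [altFunctional_genPoly, kernelSum, Finset.mul_sum]
      exact Finset.sum_comm
    rw [this]
    exact Finset.sum_eq_zero fun S hS =>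
      altFunctional_genPoly_charProd hx z (Finset.mem_filter.1 hS).2
  have hc := congrArg (altFunctional (t - dist1 x)) (genPoly_const x (lam / (s : ℝ) ^ (k - t)))
  rw [map_smul, smul_eq_mul, show k - dist1 x = k - t + (t - dist1 x) by omega,
    ← aSeq_eq_altFunctional] at hc
  rw [← hc]
  have hlin : altFunctional (t - dist1 x) (genPoly x (facetPoint t lam z)) =
      altFunctional (t - dist1 x) (genPoly x fun _ => lam / (s : ℝ) ^ (k - t)) -
        lam / (s : ℝ) ^ (k - t) / kernelSum t z z *
          altFunctional (t - dist1 x) (genPoly x (kernelSum t z)) := by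
    simp only [altFunctional_genPoly, facetPoint, Finset.mul_sum, ← Finset.sum_sub_distrib]
    refine Finset.sum_congr rfl fun y _ => ?_
    ring
  rw [hlin, hker, mul_zero, sub_zero]

end FacetPoints

/-! ### The inequalities of the polytope as one family indexed by `[s]^k` -/

section Functionals

variable {k s : ℕ} [NeZero s]

theorem exists_inJ_forall_ne_zero (hs : 2 ≤ s) (x : Comb k s) :
    ∃ y : Comb k s, InJ x y ∧ ∀ i, y i ≠ 0 := by
  have : Nontrivial (Fin s) := Fin.nontrivial_iff_two_le.2 hs
  obtain ⟨a, ha⟩ := exists_ne (0 : Fin s)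
  refine ⟨fun i => if x i = 0 then a else x i, fun i hi => by simp [hi], fun i => ?_⟩
  dsimp only
  split_ifs with h
  · exact ha
  · exact h

/-- The constant term of the functional attached to `w`: the coordinate `N_w` if `w` indexes a
variable, and the left-hand side of the inequality of `w` otherwise. -/
noncomputable def functionalConst (t lam : ℕ) (w : Comb k s) : ℝ :=
  if t < dist1 w then 0 else aSeq k s t lam (t - dist1 w)

/-- The coefficients of the functional attached to `w`. -/
noncomputable def functionalCoeff (t : ℕ) (w : Comb k s) (y : VarIdx k s t) : ℝ :=
  if t < dist1 w then if y.1 = w then 1 else 0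
  else if InJ w y.1 then
    (-1) ^ (t - dist1 w + 1) * ((dist1 y.1 - dist1 w - 1).choose (t - dist1 w) : ℝ)
  else 0

theorem functional_of_lt {t : ℕ} (lam : ℕ) {w : Comb k s} (hw : t < dist1 w)
    (N : VarIdx k s t → ℝ) :
    functionalConst t lam w + dotProduct (functionalCoeff t w) N = N ⟨w, hw⟩ := by
  have : functionalCoeff t w = Pi.single (⟨w, hw⟩ : VarIdx k s t) 1 := by
    funext y
    simp [functionalCoeff, hw, Pi.single_apply, Subtype.ext_iff]
  rw [this, functionalConst, if_pos hw, single_dotProduct, one_mul, zero_add]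

theorem functional_of_le {t : ℕ} (lam : ℕ) {w : Comb k s} (hw : dist1 w ≤ t)
    (N : VarIdx k s t → ℝ) :
    functionalConst t lam w + dotProduct (functionalCoeff t w) N = ineqLHS t lam w N := by
  rw [ineqLHS, functionalConst, if_neg hw.not_gt, dotProduct, Finset.sum_filter, Finset.mul_sum]
  congr 1
  refine Finset.sum_congr rfl fun y _ => ?_
  rw [functionalCoeff, if_neg hw.not_gt]
  split_ifs <;> ring

theorem mem_OAP_iff {t lam : ℕ} (N : VarIdx k s t → ℝ) :
    N ∈ OAP k s t lam ↔
      ∀ w, 0 ≤ functionalConst t lam w + dotProduct (functionalCoeff t w) N := by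
  constructor
  · rintro ⟨h1, h2⟩ w
    rcases lt_or_ge t (dist1 w) with hw | hw
    · rw [functional_of_lt lam hw]
      exact h2 _
    · rw [functional_of_le lam hw]
      exact h1 w hw
  · intro h
    refine ⟨fun x hx => ?_, fun y => ?_⟩
    · rw [← functional_of_le lam hx]
      exact h x
    · have := h y.1
      rwa [functional_of_lt lam y.2] at this

theorem functionalCoeff_ne_zero_iff {t : ℕ} {w : Comb k s} (hw : dist1 w ≤ t)
    (y : VarIdx k s t) : functionalCoeff t w y ≠ 0 ↔ InJ w y.1 := by
  rw [functionalCoeff, if_neg hw.not_gt]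
  have hy := y.2
  have : (dist1 y.1 - dist1 w - 1).choose (t - dist1 w) ≠ 0 :=
    (Nat.choose_pos (by omega)).ne'
  split_ifs with h <;> simp [h, this]

theorem exists_functionalCoeff_ne_zero (hs : 2 ≤ s) {t : ℕ} (htk : t < k) (w : Comb k s) :
    ∃ y : VarIdx k s t, functionalCoeff t w y ≠ 0 := by
  rcases lt_or_ge t (dist1 w) with hw | hw
  · exact ⟨⟨w, hw⟩, by simp [functionalCoeff, hw]⟩
  · obtain ⟨y, hy, hy0⟩ := exists_inJ_forall_ne_zero hs w
    exact ⟨⟨y, by rwa [dist1_eq_of_forall_ne_zero hy0]⟩, (functionalCoeff_ne_zero_iff hw _).2 hy⟩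

/-- A symmetry of the polytope permutes the sets `J_x ∩ Y` with `d(1, x) ≤ t`. -/
theorem exists_inJ_image {t lam : ℕ} (hs : 2 ≤ s) (htk : t < k) (h : t + 1 < k ∨ 2 < s)
    (hlam : 0 < lam) {σ : Equiv.Perm (VarIdx k s t)} (hσ : σ ∈ permSymm (OAP k s t lam))
    {x : Comb k s} (hx : dist1 x ≤ t) :
    ∃ w : Comb k s, dist1 w ≤ t ∧ ∀ y : VarIdx k s t, InJ x y.1 ↔ InJ w (σ y).1 := by
  have hval : ∀ w : Comb k s, functionalConst t lam w + dotProduct (functionalCoeff t w)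
      (fun y => facetPoint t lam x y.1) = facetPoint t lam x w := by
    intro w
    rcases lt_or_ge t (dist1 w) with hw | hw
    · rw [functional_of_lt lam hw]
    · rw [functional_of_le lam hw, ineqLHS_facetPoint htk lam x hw]
  obtain ⟨w, hw, hsupp⟩ := exists_support_image mem_OAP_iff
    (exists_functionalCoeff_ne_zero hs htk) hσ (x := x) (p := fun y => facetPoint t lam x y.1)
    (by rw [hval, facetPoint_self hs htk])
    (fun w hw => by rw [hval]; exact facetPoint_pos hs htk h hlam hw)
  -- Otherwise the facet point would vanish at the coordinate `σ⁻¹ w`, which lies in `Y` and so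
  -- differs from `x`.
  have hwt : dist1 w ≤ t := by
    by_contra hlt
    rw [functional_of_lt lam (not_le.1 hlt)] at hw
    refine (facetPoint_pos hs htk h hlam (z := x) ?_).ne' hw
    intro he
    have := (σ⁻¹ (⟨w, not_le.1 hlt⟩ : VarIdx k s t)).2
    rw [he] at this
    omega
  refine ⟨w, hwt, fun y => ?_⟩
  rw [← functionalCoeff_ne_zero_iff hx, hsupp, functionalCoeff_ne_zero_iff hwt]

end Functionals

/-! ### From the sets `J_x ∩ Y` to the wreath product -/

section Combinatorics

variable {k s t : ℕ} [NeZero s]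

/-- One coordinate can be changed without leaving `Y`: to level `1` if `t + 1 < k`, to another level
different from `1` if `2 < s`. -/
theorem exists_lt_dist1_update (htk : t < k) (h : t + 1 < k ∨ 2 < s) {y : Comb k s}
    (hy : ∀ i, y i ≠ 0) (i : Fin k) : ∃ b, b ≠ y i ∧ t < dist1 (Function.update y i b) := by
  rcases h with h | h
  · refine ⟨0, (hy i).symm, ?_⟩
    have : (Finset.univ.filter fun j => Function.update y i 0 j ≠ 0) = Finset.univ.erase i := by
      ext j
      by_cases hj : j = i
      · simp [hj]
      · simp [hj, hy j]
    rw [dist1_eq_card, this, Finset.card_erase_of_mem (Finset.mem_univ i), Finset.card_univ,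
      Fintype.card_fin]
    omega
  · obtain ⟨b, -, hb⟩ := Finset.exists_mem_notMem_of_card_lt_card
      (s := {0, y i}) (t := (Finset.univ : Finset (Fin s)))
      (Finset.card_le_two.trans_lt (by simpa using h))
    simp only [Finset.mem_insert, Finset.mem_singleton, not_or] at hb
    refine ⟨b, hb.2, ?_⟩
    rwa [dist1_eq_of_forall_ne_zero]
    intro j
    by_cases hj : j = i
    · subst hj
      simpa using hb.1
    · simpa [hj] using hy j

/-- If `x'` fixed a coordinate free in `x`, changing that coordinate of some `y` would leave `J_x'`
but not `J_x ∩ Y`. -/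
theorem inJ_of_forall (hs : 2 ≤ s) (htk : t < k) (h : t + 1 < k ∨ 2 < s) {x x' : Comb k s}
    (hsub : ∀ y : VarIdx k s t, InJ x y.1 → InJ x' y.1) : InJ x' x := by
  intro i hi
  obtain ⟨y, hxy, hy⟩ := exists_inJ_forall_ne_zero hs x
  have hyi := hsub ⟨y, by rwa [dist1_eq_of_forall_ne_zero hy]⟩ hxy i hi
  by_cases hx : x i = 0
  · obtain ⟨b, hb, hbt⟩ := exists_lt_dist1_update htk h hy i
    have hJ : InJ x (Function.update y i b) := by
      intro j hj
      have hji : j ≠ i := by rintro rfl; exact hj hx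
      simpa [hji] using hxy j hj
    have := hsub ⟨_, hbt⟩ hJ i hi
    simp only [Function.update_self] at this
    exact absurd (this.trans hyi.symm) hb
  · exact (hxy i hx).symm.trans hyi

theorem InJ.antisymm {x y : Comb k s} (h : InJ x y) (h' : InJ y x) : x = y := by
  funext i
  by_cases hx : x i = 0
  · by_cases hy : y i = 0
    · rw [hx, hy]
    · exact h' i hy
  · exact (h i hx).symm

theorem InJ.trans {x y z : Comb k s} (h : InJ x y) (h' : InJ y z) : InJ x z := by
  intro i hi
  have := h i hi
  rw [h' i (by rwa [this]), this]

theorem inJ_single_iff {i : Fin k} {a : Fin s} (ha : a ≠ 0) (y : Comb k s) :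
    InJ (Pi.single i a) y ↔ y i = a := by
  constructor
  · intro h
    simpa using h i (by simpa using ha)
  · intro h j hj
    by_cases hji : j = i
    · subst hji
      simpa using h
    · simp [hji] at hj

theorem dist1_single {i : Fin k} {a : Fin s} (ha : a ≠ 0) :
    dist1 (Pi.single i a : Comb k s) = 1 := by
  rw [dist1_eq_card, Finset.card_eq_one]
  refine ⟨i, ?_⟩
  ext j
  by_cases hj : j = i
  · subst hj
    simpa using ha
  · simp [hj]

theorem exists_level_image {lam : ℕ} (hs : 2 ≤ s) (ht : 0 < t) (htk : t < k)
    (h : t + 1 < k ∨ 2 < s) (hlam : 0 < lam) {σ : Equiv.Perm (VarIdx k s t)}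
    (hσ : σ ∈ permSymm (OAP k s t lam)) (i : Fin k) {a : Fin s} (ha : a ≠ 0) :
    ∃ (j : Fin k) (b : Fin s), b ≠ 0 ∧ ∀ y : VarIdx k s t, y.1 i = a ↔ (σ y).1 j = b := by
  obtain ⟨w, -, hw⟩ := exists_inJ_image hs htk h hlam hσ
    (x := Pi.single i a) (by rw [dist1_single ha]; omega)
  have hne : ∀ x : Comb k s, (∀ y : VarIdx k s t, InJ x y.1) → x = 0 := fun x hx =>
    InJ.antisymm (inJ_of_forall hs htk h fun y _ => hx y) (by intro i hi; exact absurd rfl hi)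
  have hw0 : w ≠ 0 := by
    rintro rfl
    have := congrFun (hne (Pi.single i a) fun y => (hw y).2 fun i hi => absurd rfl hi) i
    simp only [Pi.single_eq_same] at this
    exact ha this
  obtain ⟨j, hj⟩ := Function.ne_iff.1 hw0
  refine ⟨j, w j, hj, fun y => ?_⟩
  -- The level set `y j = w j` contains `J_w ∩ Y`. Its preimage is some `J_x ∩ Y` that contains the
  -- original level set and is proper, hence equal to it by maximality.
  obtain ⟨x, -, hx⟩ := exists_inJ_image hs htk h hlam (inv_mem hσ)
    (x := Pi.single j (w j)) (by rw [dist1_single hj]; omega)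
  have hx' : ∀ y : VarIdx k s t, InJ x y.1 ↔ InJ (Pi.single j (w j)) (σ y).1 := fun y => by
    simpa using (hx (σ y)).symm
  have hxle : InJ x (Pi.single i a) := inJ_of_forall hs htk h fun y hy =>
    (hx' y).2 ((inJ_single_iff hj _).2 ((hw y).1 hy j hj))
  have hx0 : x ≠ 0 := by
    rintro rfl
    have := congrFun (hne (Pi.single j (w j)) fun y => by
      have := (hx' (σ⁻¹ y)).1 fun i hi => absurd rfl hi
      simpa using this) j
    simp only [Pi.single_eq_same] at this
    exact hj this
  have hxi : x = Pi.single i a := by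
    by_contra hxne
    have h1 := hxle.dist1_lt (Ne.symm hxne)
    rw [dist1_single ha, Nat.lt_one_iff] at h1
    exact hx0 (hammingDist_eq_zero.1 h1).symm
  rw [← inJ_single_iff ha, ← hxi, hx' y, inJ_single_iff hj]

theorem mem_range_wreathHom_of_level_image (hs : 2 ≤ s) (htk : t < k) (h : t + 1 < k ∨ 2 < s)
    {σ : Equiv.Perm (VarIdx k s t)}
    (H : ∀ (i : Fin k) (a : Fin s), a ≠ 0 →
      ∃ (j : Fin k) (b : Fin s), b ≠ 0 ∧ ∀ y : VarIdx k s t, y.1 i = a ↔ (σ y).1 j = b) :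
    σ ∈ (wreathHom k s t).range := by
  have : Nontrivial (Fin s) := Fin.nontrivial_iff_two_le.2 hs
  obtain ⟨e, he⟩ := exists_ne (0 : Fin s)
  choose! J B hB0 hJB using H
  have hex : ∀ x : Comb k s, ∃ y : VarIdx k s t, InJ x y.1 ∧ ∀ i, y.1 i ≠ 0 := fun x => by
    obtain ⟨y, h1, h2⟩ := exists_inJ_forall_ne_zero hs x
    exact ⟨⟨y, by rwa [dist1_eq_of_forall_ne_zero h2]⟩, h1, h2⟩
  have htwo : ∀ (i j : Fin k) (a b : Fin s), i ≠ j → a ≠ 0 → b ≠ 0 →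
      ∃ y : VarIdx k s t, (y.1 i = a ∧ y.1 j = b) ∧ ∀ i, y.1 i ≠ 0 := by
    intro i j a b hij ha hb
    obtain ⟨y, h1, h2⟩ := hex (Function.update (Pi.single i a) j b)
    refine ⟨y, ⟨?_, ?_⟩, h2⟩
    · simpa [hij] using h1 i (by simpa [hij] using ha)
    · simpa using h1 j (by simpa using hb)
  -- Distinct levels of one factor have disjoint level sets, whereas level sets of distinct factors
  -- meet; so the image factor depends on `i` only.
  have hJ : ∀ i a, a ≠ 0 → J i a = J i e := by
    intro i a ha
    by_contra hne
    have hae : a ≠ e := by rintro rfl; exact hne rfl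
    obtain ⟨y, ⟨h1, h2⟩, -⟩ := htwo _ _ _ _ hne (hB0 i a ha) (hB0 i e he)
    have e1 := (hJB i a ha (σ⁻¹ y)).2 (by simpa using h1)
    have e2 := (hJB i e he (σ⁻¹ y)).2 (by simpa using h2)
    exact hae (e1.symm.trans e2)
  have hJB' : ∀ i a, a ≠ 0 → ∀ y : VarIdx k s t, y.1 i = a ↔ (σ y).1 (J i e) = B i a := by
    intro i a ha y
    rw [hJB i a ha y, hJ i a ha]
  have hBinj : ∀ i, Function.Injective fun a : NonOne s => (⟨B i a, hB0 i a a.2⟩ : NonOne s) := by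
    intro i a a' haa
    have haa : B i a = B i a' := congrArg Subtype.val haa
    obtain ⟨y, h1, -⟩ := hex (Pi.single i a.1)
    have h1 := (inJ_single_iff a.2 _).1 h1
    have h2 := (hJB' i a' a'.2 y).2 (haa ▸ (hJB' i a a.2 y).1 h1)
    exact Subtype.ext (h1.symm.trans h2)
  let g : Fin k → Equiv.Perm (NonOne s) := fun i =>
    Equiv.ofBijective _ (Finite.injective_iff_bijective.1 (hBinj i))
  have hg : ∀ i (a : NonOne s), ((g i a : NonOne s) : Fin s) = B i a := fun _ _ => rfl
  -- Two factors with the same image would share a level set, but one coordinate can be changed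
  -- while the other is kept.
  have hπinj : Function.Injective fun i => J i e := by
    intro i i' hii
    dsimp only at hii
    by_contra hne
    obtain ⟨a, ha⟩ := (g i').surjective ⟨B i e, hB0 i e he⟩
    have ha : B i' a = B i e := by rw [← hg, ha]
    have hiff : ∀ y : VarIdx k s t, y.1 i = e ↔ y.1 i' = a := fun y => by
      rw [hJB' i e he, hJB' i' a a.2, hii, ha]
    obtain ⟨y, ⟨h1, h2⟩, hy⟩ := htwo i i' e a hne he a.2
    obtain ⟨b, hb, hbt⟩ := exists_lt_dist1_update htk h hy i
    have := (hiff ⟨_, hbt⟩).2 (by simpa [Ne.symm hne] using h2)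
    simp only [Function.update_self] at this
    exact hb (this.trans h1.symm)
  let π : Equiv.Perm (Fin k) :=
    Equiv.ofBijective _ (Finite.injective_iff_bijective.1 hπinj)
  refine ⟨⟨fun j => g (π⁻¹ j), π⟩, ?_⟩
  ext y : 2
  funext j
  obtain ⟨i, rfl⟩ := π.surjective j
  change Equiv.Perm.ofSubtype (g (π⁻¹ (π i))) (y.1 (π⁻¹ (π i))) = (σ y).1 (π i)
  rw [show π⁻¹ (π i) = i from π.symm_apply_apply i]
  -- Level `1` is not covered by the level sets; it is recovered as lying in none of them.
  by_cases hy : y.1 i = 0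
  · rw [Equiv.Perm.ofSubtype_apply_of_not_mem _ (by simpa using hy), hy]
    by_contra hne
    obtain ⟨a, ha⟩ := (g i).surjective ⟨(σ y).1 (π i), Ne.symm hne⟩
    have ha : B i a = (σ y).1 (π i) := by rw [← hg, ha]
    exact a.2 (((hJB' i a a.2 y).2 ha.symm).symm.trans hy)
  · rw [Equiv.Perm.ofSubtype_apply_of_mem (p := fun a : Fin s => a ≠ 0) (g i) hy, hg]
    exact ((hJB' i _ hy y).1 rfl).symm

theorem wreathHom_injective (hs : 2 ≤ s) (htk : t < k) (h : t + 1 < k ∨ 2 < s) :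
    Function.Injective (wreathHom k s t) := by
  rw [injective_iff_map_eq_one]
  intro w hw
  have hfix : ∀ y : Comb k s, t < dist1 y → ∀ i,
      Equiv.Perm.ofSubtype (w.left i) (y (w.right⁻¹ i)) = y i := fun y hy i =>
    congrFun (congrArg Subtype.val (DFunLike.congr_fun hw (⟨y, hy⟩ : VarIdx k s t))) i
  have hr : ∀ i, w.right⁻¹ i = i := by
    intro i
    by_contra hne
    obtain ⟨y, -, hy⟩ := exists_inJ_forall_ne_zero hs (0 : Comb k s)
    obtain ⟨b, hb, hbt⟩ := exists_lt_dist1_update htk h hy i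
    have h1 := hfix y (by rwa [dist1_eq_of_forall_ne_zero hy]) i
    have h2 := hfix _ hbt i
    rw [Function.update_of_ne hne, Function.update_self, h1] at h2
    exact hb h2.symm
  refine SemidirectProduct.ext ?_ ?_
  · funext i
    ext a : 2
    have hy : ∀ j : Fin k, (fun _ => a.1 : Comb k s) j ≠ 0 := fun _ => a.2
    have := hfix (fun _ => a.1) (by rwa [dist1_eq_of_forall_ne_zero hy]) i
    exact (Equiv.Perm.ofSubtype_apply_of_mem (w.left i) a.2).symm.trans this
  · ext i : 1
    rw [SemidirectProduct.one_right, Equiv.Perm.one_apply]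
    conv_lhs => rw [← hr i]
    simp

/-! ### Invariance under the wreath product -/

theorem inJ_wreathAct_iff (w : Wreath (Equiv.Perm (NonOne s)) k) (x y : Comb k s) :
    InJ (wreathAct w x) (wreathAct w y) ↔ InJ x y := by
  have key : ∀ (w : Wreath (Equiv.Perm (NonOne s)) k) (x y : Comb k s), InJ x y →
      InJ (wreathAct w x) (wreathAct w y) := by
    intro w x y hxy i hi
    have hx : x (w.right⁻¹ i) ≠ 0 := by
      intro h0
      refine hi ?_
      rw [wreathAct, h0]
      exact Equiv.Perm.ofSubtype_apply_of_not_mem _ (by simp)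
    rw [wreathAct, wreathAct, hxy _ hx]
  refine ⟨fun h => ?_, key w x y⟩
  have := key w⁻¹ _ _ h
  rwa [← wreathAct_mul, ← wreathAct_mul, inv_mul_cancel, wreathAct_one, wreathAct_one] at this

theorem ineqLHS_wreathHom (t lam : ℕ) (w : Wreath (Equiv.Perm (NonOne s)) k) (x : Comb k s)
    (N : VarIdx k s t → ℝ) :
    ineqLHS t lam (wreathAct w x) (permCoord (wreathHom k s t w) N) = ineqLHS t lam x N := by
  have hval : ∀ y : VarIdx k s t, (wreathHom k s t w y).1 = wreathAct w y.1 := fun _ => rfl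
  rw [ineqLHS, ineqLHS, dist1_wreathAct, Finset.sum_filter, Finset.sum_filter,
    ← Equiv.sum_comp (wreathHom k s t w)]
  simp only [hval, inJ_wreathAct_iff, dist1_wreathAct, permCoord]
  simp

theorem mem_permSymm_of_forall {ι : Type*} {P : Set (ι → ℝ)} {G : Subgroup (Equiv.Perm ι)}
    (h : ∀ σ ∈ G, ∀ N ∈ P, permCoord σ N ∈ P) : G ≤ permSymm P := by
  intro σ hσ
  refine Set.Subset.antisymm (Set.image_subset_iff.2 fun N hN => h σ hσ N hN) fun N hN => ?_
  refine ⟨permCoord σ⁻¹ N, h _ (inv_mem hσ) N hN, ?_⟩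
  rw [← Function.comp_apply (f := permCoord σ), ← permCoord_mul, mul_inv_cancel, permCoord_one,
    id]

theorem range_wreathHom_le_permSymm (t lam : ℕ) :
    (wreathHom k s t).range ≤ permSymm (OAP k s t lam) := by
  refine mem_permSymm_of_forall ?_
  rintro _ ⟨w, rfl⟩ N ⟨h1, h2⟩
  refine ⟨fun x hx => ?_, fun y => h2 _⟩
  have hx' : wreathAct w (wreathAct w⁻¹ x) = x := by
    rw [← wreathAct_mul, mul_inv_cancel, wreathAct_one]
  rw [← hx', ineqLHS_wreathHom]
  exact h1 _ (by rwa [dist1_wreathAct])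

theorem permSymm_OAP_eq_range {lam : ℕ} (hs : 2 ≤ s) (ht : 0 < t) (htk : t < k)
    (h : t + 1 < k ∨ 2 < s) (hlam : 0 < lam) :
    permSymm (OAP k s t lam) = (wreathHom k s t).range :=
  le_antisymm (fun _ hσ => mem_range_wreathHom_of_level_image hs htk h fun i _ ha =>
    exists_level_image hs ht htk h hlam hσ i ha) (range_wreathHom_le_permSymm t lam)

/-! ### Degenerate cases and assembly -/

theorem permSymm_OAP_zero (k s lam : ℕ) [NeZero s] : permSymm (OAP k s 0 lam) = ⊤ := by
  refine top_le_iff.1 (mem_permSymm_of_forall ?_)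
  rintro σ - N ⟨h1, h2⟩
  refine ⟨fun x hx => ?_, fun y => h2 _⟩
  obtain rfl : x = 0 := (hammingDist_eq_zero.1 (Nat.le_zero.1 hx)).symm
  have hJ : ∀ y : Comb k s, InJ 0 y := fun y i hi => absurd rfl hi
  have := h1 0 hx
  simp only [ineqLHS, hJ, Finset.filter_true, Nat.zero_sub, Nat.choose_zero_right, Nat.cast_one,
    one_mul] at this ⊢
  rw [← Equiv.sum_comp σ]
  simpa [permCoord] using this

theorem card_varIdx_zero (k s : ℕ) [NeZero s] : Fintype.card (VarIdx k s 0) = s ^ k - 1 := by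
  have : ∀ y : Comb k s, 0 < dist1 y ↔ y ≠ 0 := fun y => by
    rw [dist1, hammingDist_pos, ne_comm]
  rw [Fintype.card_congr (Equiv.subtypeEquivRight this), Fintype.card_subtype_compl]
  simp

/-- For `t = k` the set `Y` is empty; for `t + 1 = k` and `s = 2` it contains only the combination
with no level `1`. -/
theorem subsingleton_varIdx (hs : 2 ≤ s) (htk : t ≤ k) (h : ¬ (t < k ∧ (t + 1 < k ∨ 2 < s))) :
    Subsingleton (VarIdx k s t) := by
  refine ⟨fun y z => Subtype.ext ?_⟩
  have hy := y.2
  have hz := z.2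
  have hy' := dist1_le y.1
  have hz' := dist1_le z.1
  have hfull : ∀ x : Comb k s, dist1 x = k → ∀ i, x i ≠ 0 := by
    intro x hx i
    rw [dist1_eq_card] at hx
    have := Finset.eq_univ_of_card _ (hx.trans (Fintype.card_fin k).symm)
    simpa using this.ge (Finset.mem_univ i)
  have h2 : s = 2 := by omega
  subst h2
  funext i
  have h1 := hfull y.1 (by omega) i
  have h2 := hfull z.1 (by omega) i
  omega

/-- Wreath products with `S_k` of isomorphic groups are isomorphic. -/
def wreathCongr {G H : Type*} [Group G] [Group H] (e : G ≃* H) (k : ℕ) :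
    Wreath G k ≃* Wreath H k :=
  SemidirectProduct.congr (MulEquiv.piCongrRight fun _ => e) (MulEquiv.refl _) fun _ => rfl

end Combinatorics
end OAPoly

theorem mainTheorem1 (k s t lam : ℕ) [NeZero s] (hs : 2 ≤ s) (htk : t ≤ k) (hlam : 0 < lam) :
    OAPoly.permSymm (OAPoly.OAP k s t lam) = OAPoly.HGroup k s t ∧
    (t = 0 →
      Nonempty (OAPoly.permSymm (OAPoly.OAP k s t lam) ≃* Equiv.Perm (Fin (s ^ k - 1)))) ∧
    (0 < t → t < k → (t + 1 < k ∨ 2 < s) →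
      Function.Injective (OAPoly.wreathHom k s t) ∧
      Nonempty (OAPoly.permSymm (OAPoly.OAP k s t lam) ≃*
        OAPoly.Wreath (Equiv.Perm (Fin (s - 1))) k)) ∧
    (0 < t → ¬ (t < k ∧ (t + 1 < k ∨ 2 < s)) →
      OAPoly.permSymm (OAPoly.OAP k s t lam) = ⊥) := by
  have hbot : ¬ (t < k ∧ (t + 1 < k ∨ 2 < s)) →
      OAPoly.permSymm (OAPoly.OAP k s t lam) = ⊥ := fun h => by
    have := OAPoly.subsingleton_varIdx hs htk h
    exact Subsingleton.elim _ _
  refine ⟨?_, ?_, ?_, fun _ => hbot⟩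
  · rw [OAPoly.HGroup]
    split_ifs with h0 h
    · subst h0
      exact OAPoly.permSymm_OAP_zero k s lam
    · exact OAPoly.permSymm_OAP_eq_range hs (Nat.pos_of_ne_zero h0) h.1 h.2 hlam
    · exact hbot h
  · rintro rfl
    rw [OAPoly.permSymm_OAP_zero]
    exact ⟨Subgroup.topEquiv.trans
      (Fintype.equivFinOfCardEq (OAPoly.card_varIdx_zero k s)).permCongrHom⟩
  · intro ht htk h
    have hinj := OAPoly.wreathHom_injective hs htk h
    refine ⟨hinj, ?_⟩
    rw [OAPoly.permSymm_OAP_eq_range hs ht htk h hlam]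
    have hcard : Fintype.card (OAPoly.NonOne s) = s - 1 := by
      rw [Fintype.card_subtype_compl]
      simp
    exact ⟨(MonoidHom.ofInjective hinj).symm.trans
      (OAPoly.wreathCongr (Fintype.equivFinOfCardEq hcard).permCongrHom k)⟩
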